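/- Let $\mathbb K=\mathbb R$ or $\mathbb C$, let $X,Y$ be separable Hilbert spaces over $\mathbb K$ (inner products linear in the first argument), and let $L:\mathcal D(L)\subset X\to Y$ be an injective linear operator, with inverse $L^{-1}$ defined on $\mathcal D(L^{-1})=\mathcal R(L)$. A linear operator $T$ with domain $\mathcal D(T)$ is called bounded if $\|Tv\|\le M\|v\|$ for some $M$ and all $v\in\mathcal D(T)$. Let $K:S\to X$ be the POD operator of data $\{w_j\}$, in one of the following two cases. (Discrete case) $S=\mathbb K^s$ with inner product $(u,v)_S=\sum_{j=1}^s\gamma_ju_j\overline{v_j}$, where $s\ge1$ and $\gamma_j>0$; $w_1,\dots,w_s\in\mathcal D(L)$; and $Kf=\sum_{j=1}^s\gamma_jf_jw_j$. (Continuous case) $S=L^2(\mathcal O;\mathbb K^m)$ with $\mathcal O\subset\mathbb R^d$ open and $d,m\ge1$; $w_1,\dots,w_m\in L^2(\mathcal O;X)$; $Kf=\sum_{j=1}^m\int_{\mathcal O}f_j(t)w_j(t)\,dt$; and it is assumed that $w_j(t)\in\mathcal D(L)$ for a.e. $t$, that $Lw_j\in L^2(\mathcal O;Y)$, and that $Kf\in\mathcal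 D(L)$ and $LKf=\sum_{j=1}^m\int_{\mathcal O}f_j(t)Lw_j(t)\,dt$ for all $f\in S$. Let $Kf=\sum_{k\ge1}\sigma_k(f,f_k)_S\varphi_k$ be a singular value decomposition of $K$, with singular values $\sigma_1\ge\sigma_2\ge\dots\ge0$ repeated according to multiplicity and with $\{f_k\}\subset S$ and $\{\varphi_k\}\subset X$ orthonormal; in the sums below the terms with $\sigma_k=0$ are zero. Let $s_X=\operatorname{rank}(K)\in\{0,1,2,\dots,\infty\}$. The POD eigenvalues of $\{w_j\}$ are the eigenvalues of $KK^*:X\to X$. For each integer $r\ge1$ with $\sigma_r>0$ (that is, $1\le r\le s_X$), let $X_r=\operatorname{span}\{\varphi_1,\dots,\varphi_r\}\subset\mathcal D(L)$, and let $\Pi_r^Y:Y\to Y$ be a bounded, not necessarily orthogonal, projection onto $Y_r=LX_r$. Only such $r$ are considered; if $s_X<\infty$, convergence as $r$ increases means that the error is zero at $r=s_X$ (if $s_X\geq 1$), and if $s_X=\infty$ it means convergence as $r\to\infty$. The operator $L^{-1}\Pi_r^YL$ has domain $\mathcal D(L)$, and $\{L^{-1}\Pi_r^YL\}$ is uniformly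 bounded if there is a constant $C$ with $\|L^{-1}\Pi_r^YLx\|_X\le C\|x\|_X$ for all $r$ and all $x\in\mathcal D(L)$. Assume that $s_X<\infty$, or that $L$ is bounded, or that $L^{-1}$ is bounded. Then the following hold. 1. If $x=Kg$ with $g\in S$, then for every such $r$ $$\|x-L^{-1}\Pi_r^YLx\|_X\le\sum_{k>r}\sigma_k\,|(g,f_k)_S|\,\|\varphi_k-L^{-1}\Pi_r^YL\varphi_k\|_X,$$ and the series on the right-hand side converges. 2. For every $x=Kg$ with $g\in S$, the error $\|x-L^{-1}\Pi_r^YLx\|_X$ converges to zero as $r$ increases in each of the following cases: $s_X<\infty$; or $L^{-1}$ is bounded and $\{\Pi_r^Y\}$ is uniformly bounded in operator norm; or $\{L^{-1}\Pi_r^YL\}$ is uniformly bounded. 3. If all POD eigenvalues of $\{w_j\}$ are nonzero and, in the case $s_X=\infty$, $\{L^{-1}\Pi_r^YL\}$ is uniformly bounded, then $L^{-1}\Pi_r^YLx\to x$ as $r$ increases for all $x\in X$; here $\mathcal D(L)$ is dense in $X$, and $L^{-1}\Pi_r^YL$ stands for its unique bounded extension to $X$. -/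

import Mathlib

open MeasureTheory Filter Topology

universe u v w

noncomputable section

/-! ### Unbounded operators and the operators `L⁻¹ Π L` -/

section Operators

variable {𝕜 X Y : Type*} [RCLike 𝕜]
  [NormedAddCommGroup X] [InnerProductSpace 𝕜 X]
  [NormedAddCommGroup Y] [InnerProductSpace 𝕜 Y]

/-- A linear operator `T : D(T) ⊆ X → Y` is bounded if `‖T x‖ ≤ M ‖x‖` for all `x ∈ D(T)`. -/
def LinearPMap.IsBddOp (T : X →ₗ.[𝕜] Y) : Prop :=
  ∃ M : ℝ, ∀ x : T.domain, ‖T x‖ ≤ M * ‖(x : X)‖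

/-- The image `L U = {L x | x ∈ U ∩ D(L)}` of a subspace `U` of `X`. -/
def LinearPMap.imageOf (L : X →ₗ.[𝕜] Y) (U : Submodule 𝕜 X) : Submodule 𝕜 Y :=
  (U.comap L.domain.subtype).map L.toFun

theorem LinearPMap.imageOf_le_inverse_domain (L : X →ₗ.[𝕜] Y) (U : Submodule 𝕜 X) :
    L.imageOf U ≤ L.inverse.domain := by
  rw [LinearPMap.inverse_domain]
  exact LinearMap.map_le_range

/-- The operator `L⁻¹ Π L : D(L) → X`, where `Π : Y → Y` is a projection onto `L U`.  Here `L⁻¹` is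
the inverse of the (injective) operator `L`, with domain the range of `L`. -/
def conjProj (L : X →ₗ.[𝕜] Y) {U : Submodule 𝕜 X} (P : Y →L[𝕜] Y)
    (hP : LinearMap.IsProj (L.imageOf U) P) : L.domain →ₗ[𝕜] X :=
  L.inverse.toFun ∘ₗ
    ((P : Y →ₗ[𝕜] Y) ∘ₗ L.toFun).codRestrict L.inverse.domain
      (fun x => L.imageOf_le_inverse_domain U (hP.map_mem (L x)))

end Operators

/-! ### Discrete POD operators -/

/-- The space `𝕜ˢ` with the weighted inner product `(u, v) = ∑ j, γ j * u j * conj (v j)`, for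
positive weights `γ`. -/
def WeightedSpace (𝕜 : Type*) {s : ℕ} (_γ : Fin s → Set.Ioi (0 : ℝ)) : Type _ := Fin s → 𝕜

namespace WeightedSpace

variable {𝕜 : Type*} [RCLike 𝕜] {s : ℕ} {γ : Fin s → Set.Ioi (0 : ℝ)}

instance : AddCommGroup (WeightedSpace 𝕜 γ) := inferInstanceAs (AddCommGroup (Fin s → 𝕜))

instance : Module 𝕜 (WeightedSpace 𝕜 γ) := inferInstanceAs (Module 𝕜 (Fin s → 𝕜))

/-- The `j`-th coordinate of a vector. -/
def coord (j : Fin s) : WeightedSpace 𝕜 γ →ₗ[𝕜] 𝕜 := LinearMap.proj (φ := fun _ : Fin s => 𝕜) j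

theorem ext_coord {u v : WeightedSpace 𝕜 γ} (h : ∀ j, coord j u = coord j v) : u = v :=
  funext h

/-- Mathlib's inner products are conjugate linear in the first argument, so `inner 𝕜 u v` is the
inner product `(v, u)` of the convention that is linear in the first argument. -/
instance core : InnerProductSpace.Core 𝕜 (WeightedSpace 𝕜 γ) where
  inner u v := ∑ j, ((γ j : ℝ) : 𝕜) * ((starRingEnd 𝕜) (coord j u) * coord j v)
  conj_inner_symm u v := by
    simp only [map_sum, map_mul, RCLike.conj_conj, RCLike.conj_ofReal]
    exact Finset.sum_congr rfl fun j _ => by ring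
  re_inner_nonneg u := by
    rw [map_sum]
    refine Finset.sum_nonneg fun j _ => ?_
    rw [RCLike.re_ofReal_mul, RCLike.conj_mul, ← RCLike.ofReal_pow, RCLike.ofReal_re]
    exact mul_nonneg (le_of_lt (γ j).2) (sq_nonneg _)
  add_left u v w := by
    simp only [map_add, ← Finset.sum_add_distrib]
    exact Finset.sum_congr rfl fun j _ => by ring
  smul_left u v r := by
    simp only [map_smul, smul_eq_mul, map_mul, Finset.mul_sum]
    exact Finset.sum_congr rfl fun j _ => by ring
  definite u h := by
    have h' : ∑ j, (γ j : ℝ) * ‖coord j u‖ ^ 2 = 0 := by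
      have h2 := congrArg (RCLike.re (K := 𝕜)) h
      rw [map_sum, map_zero] at h2
      refine Eq.trans ?_ h2
      refine Finset.sum_congr rfl fun j _ => ?_
      rw [RCLike.re_ofReal_mul, RCLike.conj_mul, ← RCLike.ofReal_pow, RCLike.ofReal_re]
    rw [Finset.sum_eq_zero_iff_of_nonneg
      (fun j _ => mul_nonneg (le_of_lt (γ j).2) (sq_nonneg _))] at h'
    refine ext_coord fun j => ?_
    have h3 := h' j (Finset.mem_univ j)
    have hγ : (γ j : ℝ) ≠ 0 := ne_of_gt (γ j).2
    simpa [hγ] using h3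

instance : NormedAddCommGroup (WeightedSpace 𝕜 γ) := core.toNormedAddCommGroup

instance : InnerProductSpace 𝕜 (WeightedSpace 𝕜 γ) := InnerProductSpace.ofCore core.toCore

instance : FiniteDimensional 𝕜 (WeightedSpace 𝕜 γ) :=
  inferInstanceAs (FiniteDimensional 𝕜 (Fin s → 𝕜))

instance : CompleteSpace (WeightedSpace 𝕜 γ) := FiniteDimensional.complete 𝕜 _

theorem inner_def (u v : WeightedSpace 𝕜 γ) :
    inner 𝕜 u v = ∑ j, ((γ j : ℝ) : 𝕜) * ((starRingEnd 𝕜) (coord j u) * coord j v) := rfl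

end WeightedSpace

/-- The POD operator `K f = ∑ j, γ j * f j • w j` of discrete data `w`. -/
def discretePODOperator {𝕜 X : Type*} [RCLike 𝕜] [NormedAddCommGroup X] [InnerProductSpace 𝕜 X]
    {s : ℕ} (γ : Fin s → Set.Ioi (0 : ℝ)) (w : Fin s → X) : WeightedSpace 𝕜 γ →L[𝕜] X :=
  LinearMap.toContinuousLinearMap
    (∑ j, (((γ j : ℝ) : 𝕜) • WeightedSpace.coord j).smulRight (w j))

theorem discretePODOperator_apply {𝕜 X : Type*} [RCLike 𝕜] [NormedAddCommGroup X]
    [InnerProductSpace 𝕜 X] {s : ℕ} (γ : Fin s → Set.Ioi (0 : ℝ)) (w : Fin s → X)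
    (f : WeightedSpace 𝕜 γ) :
    discretePODOperator γ w f
      = ∑ j, (((γ j : ℝ) : 𝕜) * WeightedSpace.coord j f) • w j := by
  simp [discretePODOperator, RCLike.real_smul_eq_coe_mul]

/-! ### Continuous POD operators -/

section Continuous

variable {𝕜 X : Type*} [RCLike 𝕜]
  [NormedAddCommGroup X] [InnerProductSpace 𝕜 X] [CompleteSpace X]
  {d m : ℕ} {O : Set (EuclideanSpace ℝ (Fin d))}

/-- The space `L²(O; 𝕜ᵐ)`. -/
abbrev PODL2 (𝕜 : Type*) [RCLike 𝕜] (m : ℕ) {d : ℕ} (O : Set (EuclideanSpace ℝ (Fin d))) :=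
  Lp (EuclideanSpace 𝕜 (Fin m)) 2 (volume.restrict O)

/-- The POD operator `K f = ∑ j, ∫ t in O, f j t • w j t` of continuous data `w`; see
`continuousPODOperator_apply`. -/
def continuousPODOperator (w : Fin m → Lp X 2 (volume.restrict O)) : PODL2 𝕜 m O →L[𝕜] X :=
  letI : NormedSpace ℝ X := NormedSpace.restrictScalars ℝ 𝕜 X
  haveI : IsScalarTower ℝ 𝕜 X := RestrictScalars.isScalarTower ℝ 𝕜 X
  ∑ j, (((ContinuousLinearMap.lsmul 𝕜 𝕜 (E := X)).comp
    (EuclideanSpace.proj j : EuclideanSpace 𝕜 (Fin m) →L[𝕜] 𝕜)).lpPairing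
      (volume.restrict O) 2 2).flip (w j)

theorem continuousPODOperator_apply (w : Fin m → Lp X 2 (volume.restrict O))
    (f : PODL2 𝕜 m O) :
    letI : NormedSpace ℝ X := NormedSpace.restrictScalars ℝ 𝕜 X
    continuousPODOperator w f = ∑ j, ∫ t in O, (f t) j • (w j) t := by
  let _ : NormedSpace ℝ X := NormedSpace.restrictScalars ℝ 𝕜 X
  have _ : IsScalarTower ℝ 𝕜 X := RestrictScalars.isScalarTower ℝ 𝕜 X
  simp [continuousPODOperator, ContinuousLinearMap.lpPairing_eq_integral]

end Continuous

/-! ### The POD setting -/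

/-- `IsPODOperator L K` says that `K : S → X` is the POD operator of discrete or continuous data
`{w_j}` for which the data `{L w_j}` and its POD operator `L K` make sense:
* discrete case: `S = 𝕜ˢ` with positive weights, and all `w_j` lie in `D(L)`;
* continuous case: `S = L²(O; 𝕜ᵐ)`, `w_j ∈ L²(O; X)` and `L w_j = v_j ∈ L²(O; Y)`, and for every
  `f ∈ S` one has `K f ∈ D(L)` and `L K f = ∑ j, ∫ t in O, f j t • L (w j t)`. -/
inductive IsPODOperator {𝕜 : Type u} [RCLike 𝕜]
    {X : Type v} [NormedAddCommGroup X] [InnerProductSpace 𝕜 X] [CompleteSpace X]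
    {Y : Type w} [NormedAddCommGroup Y] [InnerProductSpace 𝕜 Y] [CompleteSpace Y]
    (L : X →ₗ.[𝕜] Y) :
    ∀ {S : Type u} [NormedAddCommGroup S] [InnerProductSpace 𝕜 S], (S →L[𝕜] X) → Prop
  | discrete (s : ℕ) (hs : 0 < s) (γ : Fin s → Set.Ioi (0 : ℝ)) (w : Fin s → X)
      (hw : ∀ j, w j ∈ L.domain) :
      IsPODOperator L (discretePODOperator (𝕜 := 𝕜) γ w)
  | continuous (d m : ℕ) (hd : 0 < d) (hm : 0 < m)
      (O : Set (EuclideanSpace ℝ (Fin d))) (hO : IsOpen O)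
      (w : Fin m → Lp X 2 (volume.restrict O)) (v : Fin m → Lp Y 2 (volume.restrict O))
      (hv : ∀ j, ∀ᵐ t ∂(volume.restrict O), (w j t, v j t) ∈ L.graph)
      (hL : ∀ f : PODL2 𝕜 m O,
        (continuousPODOperator w f, continuousPODOperator v f) ∈ L.graph) :
      IsPODOperator L (continuousPODOperator (𝕜 := 𝕜) w)

theorem IsPODOperator.apply_mem_domain {𝕜 : Type u} [RCLike 𝕜]
    {X : Type v} [NormedAddCommGroup X] [InnerProductSpace 𝕜 X] [CompleteSpace X]
    {Y : Type w} [NormedAddCommGroup Y] [InnerProductSpace 𝕜 Y] [CompleteSpace Y]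
    {L : X →ₗ.[𝕜] Y} {S : Type u} [NormedAddCommGroup S] [InnerProductSpace 𝕜 S]
    {K : S →L[𝕜] X} (hK : IsPODOperator L K) (g : S) : K g ∈ L.domain := by
  induction hK with
  | discrete s hs γ w hw =>
    rw [discretePODOperator_apply]
    exact Submodule.sum_mem _ fun j _ => Submodule.smul_mem _ _ (hw j)
  | continuous d m hd hm O hO w v hv hL =>
    exact LinearPMap.mem_domain_of_mem_graph (hL g)

/-! ### Singular value decompositions, POD modes, POD eigenvalues -/

section SVD

variable {𝕜 X S : Type*} [RCLike 𝕜]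
  [NormedAddCommGroup X] [InnerProductSpace 𝕜 X]
  [NormedAddCommGroup S] [InnerProductSpace 𝕜 S]

/-- `(σ k, f k, φ k)`, `k = 1, 2, …`, is a singular value decomposition of `K`, with the singular
values in decreasing order and repeated according to multiplicity.  Only the singular vectors of the
positive singular values matter: if `σ k = 0`, then `f k` and `φ k` are arbitrary (and if `K` has
finite rank, then `σ k = 0` for all `k` beyond the rank of `K`). -/
structure IsSVD (K : S →L[𝕜] X) (σ : ℕ+ → ℝ) (f : ℕ+ → S) (φ : ℕ+ → X) : Prop where
  antitone : Antitone σ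
  nonneg : ∀ k, 0 ≤ σ k
  orthonormal_right : Orthonormal 𝕜 (fun k : {k : ℕ+ // 0 < σ k} => f k)
  orthonormal_left : Orthonormal 𝕜 (fun k : {k : ℕ+ // 0 < σ k} => φ k)
  hasSum : ∀ g : S, HasSum (fun k : ℕ+ => ((σ k : 𝕜) * inner 𝕜 (f k) g) • φ k) (K g)

theorem IsSVD.apply_right {K : S →L[𝕜] X} {σ : ℕ+ → ℝ} {f : ℕ+ → S} {φ : ℕ+ → X}
    (h : IsSVD K σ f φ) {k : ℕ+} (hk : 0 < σ k) : K (f k) = (σ k : 𝕜) • φ k := by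
  refine (h.hasSum (f k)).unique ?_
  have h1 : ((σ k : 𝕜) * inner 𝕜 (f k) (f k)) • φ k = (σ k : 𝕜) • φ k := by
    have := h.orthonormal_right.1 ⟨k, hk⟩
    simp only at this
    rw [inner_self_eq_norm_sq_to_K, this]
    simp
  rw [← h1]
  refine hasSum_single k fun l hl => ?_
  rcases (h.nonneg l).eq_or_lt with h0 | h0
  · simp [← h0]
  · have := h.orthonormal_right.2 (i := ⟨l, h0⟩) (j := ⟨k, hk⟩) (by simpa using hl)
    simp only at this
    simp [this]

/-- If the range of `K` lies in the domain `D`, then so do the modes `φ k` with `σ k > 0`. -/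
theorem IsSVD.mode_mem {K : S →L[𝕜] X} {σ : ℕ+ → ℝ} {f : ℕ+ → S} {φ : ℕ+ → X}
    (h : IsSVD K σ f φ) {D : Submodule 𝕜 X} (hD : ∀ g, K g ∈ D) {k : ℕ+} (hk : 0 < σ k) :
    φ k ∈ D := by
  have h1 : φ k = (σ k : 𝕜)⁻¹ • K (f k) := by
    rw [h.apply_right hk, smul_smul, inv_mul_cancel₀ (by exact_mod_cast hk.ne'), one_smul]
  rw [h1]
  exact D.smul_mem _ (hD _)

/-- `X_r`, the span of the modes `φ 1, …, φ r`. -/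
def modeSpan (𝕜 : Type*) [RCLike 𝕜] {X : Type*} [NormedAddCommGroup X] [InnerProductSpace 𝕜 X]
    (φ : ℕ+ → X) (r : ℕ+) : Submodule 𝕜 X :=
  Submodule.span 𝕜 (φ '' Set.Iic r)

/-- The orders `r ≥ 1` with `σ r > 0`, i.e. `1 ≤ r ≤ s_X`, for which POD projections are considered.
If `s_X` is finite, "as `r` increases" means `r` increasing up to `s_X`; this is what convergence
along `atTop` in this type says. -/
abbrev PODOrder (σ : ℕ+ → ℝ) := {r : ℕ+ // 0 < σ r}

/-- `s_X`, the rank of the POD operator, possibly infinite. -/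
def podRank (K : S →L[𝕜] X) : ℕ∞ := Cardinal.toENat (LinearMap.rank (K : S →ₗ[𝕜] X))

/-- All POD eigenvalues, i.e. all eigenvalues of `K K* : X → X`, are nonzero. -/
def PODEigenvaluesNonzero [CompleteSpace X] [CompleteSpace S] (K : S →L[𝕜] X) : Prop :=
  ∀ c : 𝕜, Module.End.HasEigenvalue
    ((K ∘L ContinuousLinearMap.adjoint K : X →L[𝕜] X) : X →ₗ[𝕜] X) c → c ≠ 0

end SVD

end

/-! The operator `L⁻¹ Π_r L` may be unbounded, but the error operator `E_r = (I - L⁻¹ Π_r L) K` is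
not. The data of `L K` make it a bounded, even Hilbert–Schmidt, operator `A`, and `B_r = L⁻¹ Π_r` is
bounded because `Π_r` has finite-dimensional range. Hence `E_r = K - B_r A` is Hilbert–Schmidt
(`IsPODOperator.exists_errorOperator`).

Since `E_r` vanishes on `ker K`, it can be expanded along the right singular vectors: `E_r g = ∑ (g,
f_k) E_r f_k`, where `E_r f_k = σ_k (φ_k - L⁻¹ Π_r L φ_k)`. The terms with `k ≤ r` are zero because
`φ_k ∈ X_r` (`IsSVD.hasSum_errorOperator`). The triangle inequality gives the error bound, and
Bessel together with the Hilbert–Schmidt property makes its right-hand side summable.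

For convergence on the range of `K`, the terms are dominated by a summable sequence independent of
`r`, so the error is at most a tail of a fixed convergent series. Nonzero POD eigenvalues make the
range of `K` dense, and uniform boundedness carries convergence from there to `X`
(`exists_extend_tendsto`). -/

/-! ### Hilbert–Schmidt operators -/

section HilbertSchmidt

variable {𝕜 S X Y : Type*} [RCLike 𝕜]
  [NormedAddCommGroup S] [InnerProductSpace 𝕜 S]
  [NormedAddCommGroup X] [InnerProductSpace 𝕜 X]
  [NormedAddCommGroup Y] [InnerProductSpace 𝕜 Y]

/-- A bounded operator is Hilbert–Schmidt if it is square summable along orthonormal families. -/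
def IsHilbertSchmidt (A : S →L[𝕜] Y) : Prop :=
  ∀ ⦃ι : Type⦄ (e : ι → S), Orthonormal 𝕜 e → Summable fun i => ‖A (e i)‖ ^ 2

theorem IsHilbertSchmidt.comp_left {A : S →L[𝕜] Y} (hA : IsHilbertSchmidt A) (B : Y →L[𝕜] X) :
    IsHilbertSchmidt (B ∘L A) := by
  intro ι e he
  refine Summable.of_nonneg_of_le (fun i => sq_nonneg _) (fun i => ?_)
    ((hA e he).mul_left (‖B‖ ^ 2))
  rw [← mul_pow]
  exact pow_le_pow_left₀ (norm_nonneg _) (B.le_opNorm _) 2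

theorem IsHilbertSchmidt.sub {A B : S →L[𝕜] Y} (hA : IsHilbertSchmidt A)
    (hB : IsHilbertSchmidt B) : IsHilbertSchmidt (A - B) := by
  intro ι e he
  refine Summable.of_nonneg_of_le (fun i => sq_nonneg _) (fun i => ?_)
    (((hA e he).add (hB e he)).mul_left 2)
  have h := norm_sub_le (A (e i)) (B (e i))
  rw [sub_apply]
  nlinarith [norm_nonneg (A (e i) - B (e i)), sq_nonneg (‖A (e i)‖ - ‖B (e i)‖)]

theorem IsHilbertSchmidt.of_finiteDimensional [FiniteDimensional 𝕜 S] (A : S →L[𝕜] Y) :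
    IsHilbertSchmidt A := by
  intro ι e he
  have : Finite ι := he.linearIndependent.finite
  exact Summable.of_finite

/-- The coefficients of `g` against an orthonormal family are summable against the norms of the
images of that family under a Hilbert–Schmidt operator. -/
theorem IsHilbertSchmidt.summable_norm_inner_mul {A : S →L[𝕜] Y} (hA : IsHilbertSchmidt A)
    {ι : Type} {e : ι → S} (he : Orthonormal 𝕜 e) (g : S) :
    Summable fun i => ‖inner 𝕜 (e i) g‖ * ‖A (e i)‖ := by
  -- By `ab ≤ a² + b²`, it suffices to sum the squares: Bessel handles the coefficients, the
  -- Hilbert–Schmidt property the images.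
  refine Summable.of_nonneg_of_le (fun i => by positivity) (fun i => ?_)
    ((he.inner_products_summable g).add (hA e he))
  nlinarith [norm_nonneg (inner 𝕜 (e i) g), norm_nonneg (A (e i)),
    sq_nonneg (‖inner 𝕜 (e i) g‖ - ‖A (e i)‖), sq_nonneg ‖A (e i)‖, sq_nonneg ‖inner 𝕜 (e i) g‖]

/-- An operator whose adjoint is uniformly square summable along finite orthonormal families is
Hilbert–Schmidt. -/
theorem IsHilbertSchmidt.of_adjoint [CompleteSpace S] [CompleteSpace Y] {A : S →L[𝕜] Y} {C : ℝ}
    (h : ∀ (n : ℕ) (b : Fin n → Y), Orthonormal 𝕜 b →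
      ∑ i, ‖ContinuousLinearMap.adjoint A (b i)‖ ^ 2 ≤ C) : IsHilbertSchmidt A := by
  intro ι e he
  refine summable_of_sum_le (c := C) (fun i => sq_nonneg _) fun F => ?_
  -- Parseval in this finite-dimensional space expands each `‖A (e k)‖²`. After passing to the
  -- adjoint and exchanging the sums, Bessel for `e` applies.
  let V : Submodule 𝕜 Y := Submodule.span 𝕜 ((fun k => A (e k)) '' (F : Set ι))
  have : FiniteDimensional 𝕜 V :=
    FiniteDimensional.span_of_finite 𝕜 (F.finite_toSet.image _)
  let b := stdOrthonormalBasis 𝕜 V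
  have hb : Orthonormal 𝕜 (fun i => (b i : Y)) := b.orthonormal.comp_linearIsometry V.subtypeₗᵢ
  calc ∑ k ∈ F, ‖A (e k)‖ ^ 2
      = ∑ k ∈ F, ∑ i, ‖inner 𝕜 (e k) (ContinuousLinearMap.adjoint A (b i : Y))‖ ^ 2 := by
        refine Finset.sum_congr rfl fun k hk => ?_
        have hmem : A (e k) ∈ V := Submodule.subset_span ⟨k, hk, rfl⟩
        have h1 := b.sum_sq_norm_inner_right ⟨A (e k), hmem⟩
        rw [Submodule.coe_norm] at h1
        rw [← h1]
        refine Finset.sum_congr rfl fun i _ => ?_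
        rw [ContinuousLinearMap.adjoint_inner_right, norm_inner_symm, Submodule.coe_inner]
    _ = ∑ i, ∑ k ∈ F, ‖inner 𝕜 (e k) (ContinuousLinearMap.adjoint A (b i : Y))‖ ^ 2 :=
        Finset.sum_comm
    _ ≤ ∑ i, ‖ContinuousLinearMap.adjoint A (b i : Y)‖ ^ 2 :=
        Finset.sum_le_sum fun i _ => he.sum_inner_products_le _
    _ ≤ C := h _ _ hb

end HilbertSchmidt

/-! ### Continuous POD operators are Hilbert–Schmidt -/

section Continuous

variable {𝕜 Y : Type*} [RCLike 𝕜]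
  [NormedAddCommGroup Y] [InnerProductSpace 𝕜 Y] [CompleteSpace Y]
  {d m : ℕ} {O : Set (EuclideanSpace ℝ (Fin d))}

theorem MeasureTheory.L2.integrable_norm_sq {α E : Type*} {_ : MeasurableSpace α} {μ : Measure α}
    [NormedAddCommGroup E] (f : Lp E 2 μ) : Integrable (fun t => ‖f t‖ ^ 2) μ :=
  (Lp.memLp f).norm.integrable_sq

theorem MeasureTheory.L2.integral_norm_sq {α E : Type*} {_ : MeasurableSpace α} {μ : Measure α}
    [NormedAddCommGroup E] [InnerProductSpace 𝕜 E] (f : Lp E 2 μ) :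
    ∫ t, ‖f t‖ ^ 2 ∂μ = ‖f‖ ^ 2 := by
  have h : ((∫ t, ‖f t‖ ^ 2 ∂μ : ℝ) : 𝕜) = ((‖f‖ ^ 2 : ℝ) : 𝕜) := by
    rw [← integral_ofReal, RCLike.ofReal_pow, ← inner_self_eq_norm_sq_to_K (𝕜 := 𝕜) f, L2.inner_def]
    simp [inner_self_eq_norm_sq_to_K]
  exact_mod_cast h

theorem MeasureTheory.L2.integrable_norm_inner_sq {α E : Type*} {_ : MeasurableSpace α}
    {μ : Measure α} [NormedAddCommGroup E] [InnerProductSpace 𝕜 E] (y : E) (v : Lp E 2 μ) :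
    Integrable (fun t => ‖inner 𝕜 y (v t)‖ ^ 2) μ :=
  ((innerSL 𝕜 y).comp_memLp v).norm.integrable_sq

/-- With `f = A* y`, one has `‖f‖² = (A f, y)`, an integral of products of `f_j` and `(v_j, y)`.
Young's inequality bounds it by half of `‖f‖²` plus half of the claimed bound, and the first half is
absorbed. This avoids computing the adjoint explicitly. -/
theorem norm_adjoint_continuousPODOperator_sq_le (v : Fin m → Lp Y 2 (volume.restrict O)) (y : Y) :
    ‖ContinuousLinearMap.adjoint (continuousPODOperator (𝕜 := 𝕜) v) y‖ ^ 2
      ≤ ∑ j, ∫ t in O, ‖inner 𝕜 y (v j t)‖ ^ 2 := by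
  let _ : NormedSpace ℝ Y := NormedSpace.restrictScalars ℝ 𝕜 Y
  have _ : IsScalarTower ℝ 𝕜 Y := RestrictScalars.isScalarTower ℝ 𝕜 Y
  set A := continuousPODOperator (𝕜 := 𝕜) v with hA
  set f : PODL2 𝕜 m O := ContinuousLinearMap.adjoint A y with hf
  have hfj (j : Fin m) : MemLp (fun t => f t j) 2 (volume.restrict O) :=
    (EuclideanSpace.proj j : EuclideanSpace 𝕜 (Fin m) →L[𝕜] 𝕜).comp_memLp f
  have hint (j : Fin m) : Integrable (fun t => f t j • v j t) (volume.restrict O) :=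
    memLp_one_iff_integrable.mp ((Lp.memLp (v j)).smul (hfj j))
  have hsq (j : Fin m) : Integrable (fun t => ‖f t j‖ ^ 2) (volume.restrict O) :=
    (hfj j).norm.integrable_sq
  have h1 : ((‖f‖ ^ 2 : ℝ) : 𝕜) = ∑ j, ∫ t in O, inner 𝕜 y (f t j • v j t) := by
    rw [RCLike.ofReal_pow, ← inner_self_eq_norm_sq_to_K (𝕜 := 𝕜) f]
    conv_lhs => rw [hf, ContinuousLinearMap.adjoint_inner_left, ← hf, hA,
      continuousPODOperator_apply, inner_sum]
    exact Finset.sum_congr rfl fun j _ => (integral_inner (hint j) y).symm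
  have h2 (j : Fin m) : ‖∫ t in O, inner 𝕜 y (f t j • v j t)‖
      ≤ 2⁻¹ * (∫ t in O, ‖f t j‖ ^ 2) + 2⁻¹ * ∫ t in O, ‖inner 𝕜 y (v j t)‖ ^ 2 := by
    rw [← integral_const_mul, ← integral_const_mul, ← integral_add]
    · refine norm_integral_le_of_norm_le (((hsq j).const_mul _).add
        ((L2.integrable_norm_inner_sq y (v j)).const_mul _)) (ae_of_all _ fun t => ?_)
      rw [inner_smul_right, norm_mul]
      nlinarith [sq_nonneg (‖f t j‖ - ‖inner 𝕜 y (v j t)‖)]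
    · exact (hsq j).const_mul _
    · exact (L2.integrable_norm_inner_sq y (v j)).const_mul _
  have h3 : ∑ j, ∫ t in O, ‖f t j‖ ^ 2 = ‖f‖ ^ 2 := by
    rw [← L2.integral_norm_sq (𝕜 := 𝕜) f, ← integral_finsetSum _ fun j _ => hsq j]
    simp only [EuclideanSpace.norm_sq_eq]
  have h4 : ‖f‖ ^ 2 ≤ 2⁻¹ * ‖f‖ ^ 2 + 2⁻¹ * ∑ j, ∫ t in O, ‖inner 𝕜 y (v j t)‖ ^ 2 := by
    calc ‖f‖ ^ 2 = ‖((‖f‖ ^ 2 : ℝ) : 𝕜)‖ := by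
          rw [RCLike.norm_ofReal, abs_of_nonneg (sq_nonneg _)]
      _ ≤ ∑ j, ‖∫ t in O, inner 𝕜 y (f t j • v j t)‖ := by rw [h1]; exact norm_sum_le _ _
      _ ≤ _ := Finset.sum_le_sum fun j _ => h2 j
      _ = _ := by rw [Finset.sum_add_distrib, ← Finset.mul_sum, ← Finset.mul_sum, h3]
  linarith

/-- Bessel's inequality in `Y`, applied pointwise in `t` and then integrated, bounds the adjoint
uniformly on finite orthonormal families. -/
theorem isHilbertSchmidt_continuousPODOperator (v : Fin m → Lp Y 2 (volume.restrict O)) :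
    IsHilbertSchmidt (continuousPODOperator (𝕜 := 𝕜) v) := by
  refine IsHilbertSchmidt.of_adjoint (C := ∑ j, ∫ t in O, ‖v j t‖ ^ 2) fun n b hb => ?_
  refine (Finset.sum_le_sum fun i _ => norm_adjoint_continuousPODOperator_sq_le v (b i)).trans ?_
  rw [Finset.sum_comm]
  refine Finset.sum_le_sum fun j _ => ?_
  rw [← integral_finsetSum _ fun i _ => L2.integrable_norm_inner_sq (b i) (v j)]
  exact integral_mono (integrable_finsetSum _ fun i _ => L2.integrable_norm_inner_sq (b i) (v j))
    (L2.integrable_norm_sq (v j)) fun t => hb.sum_inner_products_le (v j t)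

end Continuous

/-! ### The Hilbert–Schmidt property of `K` and `L K`. -/

section PODOperator

variable {𝕜 : Type u} [RCLike 𝕜]
  {X : Type v} [NormedAddCommGroup X] [InnerProductSpace 𝕜 X] [CompleteSpace X]
  {Y : Type w} [NormedAddCommGroup Y] [InnerProductSpace 𝕜 Y] [CompleteSpace Y]
  {L : X →ₗ.[𝕜] Y} {S : Type u} [NormedAddCommGroup S] [InnerProductSpace 𝕜 S] {K : S →L[𝕜] X}

theorem IsPODOperator.isHilbertSchmidt (hK : IsPODOperator L K) : IsHilbertSchmidt K := by
  induction hK with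
  | discrete s hs γ w hw => exact IsHilbertSchmidt.of_finiteDimensional _
  | continuous d m hd hm O hO w v hv hL => exact isHilbertSchmidt_continuousPODOperator w

/-- `L K` is a Hilbert–Schmidt operator. -/
theorem IsPODOperator.exists_comp (hK : IsPODOperator L K) :
    ∃ A : S →L[𝕜] Y, IsHilbertSchmidt A ∧ ∀ g, L ⟨K g, hK.apply_mem_domain g⟩ = A g := by
  induction hK with
  | discrete s hs γ w hw =>
    refine ⟨discretePODOperator γ fun j => L ⟨w j, hw j⟩, IsHilbertSchmidt.of_finiteDimensional _, fun g => ?_⟩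
    rw [discretePODOperator_apply γ fun j => L ⟨w j, hw j⟩]
    simp only [← LinearPMap.map_smul]
    simp only [← LinearPMap.toFun_eq_coe, ← map_sum]
    congr 1
    ext1
    simp [discretePODOperator_apply]
  | continuous d m hd hm O hO w v hv hL =>
    refine ⟨continuousPODOperator v, isHilbertSchmidt_continuousPODOperator v, fun g => ?_⟩
    obtain ⟨x, hx, hy⟩ := (LinearPMap.mem_graph_iff L).mp (hL g)
    simp only at hx hy
    rw [← hy]
    congr 1
    exact Subtype.ext hx.symm

end PODOperator

/-! ### The operators `L⁻¹ Π L` -/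

section ConjProj

variable {𝕜 X Y : Type*} [RCLike 𝕜]
  [NormedAddCommGroup X] [InnerProductSpace 𝕜 X]
  [NormedAddCommGroup Y] [InnerProductSpace 𝕜 Y]
  {L : X →ₗ.[𝕜] Y} {U : Submodule 𝕜 X} {P : Y →L[𝕜] Y}

theorem conjProj_eq_self (hL : L.toFun.ker = ⊥) (hP : LinearMap.IsProj (L.imageOf U) P)
    {x : L.domain} (hx : (x : X) ∈ U) : conjProj L P hP x = x := by
  refine LinearPMap.inverse_apply_eq hL ?_
  exact (hP.map_id (L x) ⟨x, hx, rfl⟩).symm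

theorem norm_conjProj_le (hP : LinearMap.IsProj (L.imageOf U) P) {M : ℝ}
    (hM : ∀ y : L.inverse.domain, ‖L.inverse y‖ ≤ M * ‖(y : Y)‖) (x : L.domain) :
    ‖conjProj L P hP x‖ ≤ M * ‖P (L x)‖ :=
  hM ⟨P (L x), _⟩

instance [FiniteDimensional 𝕜 U] : FiniteDimensional 𝕜 (L.imageOf U) := by
  have : FiniteDimensional 𝕜 (U.comap L.domain.subtype) :=
    Module.Finite.of_injective (L.domain.subtype.restrict (p := U.comap L.domain.subtype) (q := U)
      fun x hx => hx) fun x y h => by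
        apply Subtype.ext
        apply Subtype.ext
        exact congrArg (fun z : U => (z : X)) h
  exact inferInstanceAs (FiniteDimensional 𝕜 ((U.comap L.domain.subtype).map L.toFun))

/-- For finite-dimensional `U`, the operator `L⁻¹ Π` is bounded. -/
theorem exists_conjProj_eq_comp [FiniteDimensional 𝕜 U]
    (hP : LinearMap.IsProj (L.imageOf U) P) :
    ∃ B : Y →L[𝕜] X, ∀ x : L.domain, conjProj L P hP x = B (L x) :=
  -- `Π` lands in the finite-dimensional `L U`, on which the restriction of `L⁻¹` is automatically
  -- continuous.
  ⟨(LinearMap.toContinuousLinearMap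
    (L.inverse.toFun ∘ₗ Submodule.inclusion (L.imageOf_le_inverse_domain U))) ∘L
      P.codRestrict (L.imageOf U) hP.map_mem, fun _ => rfl⟩

end ConjProj

/-! ### Singular value expansions -/

section SVD

variable {𝕜 X S Z : Type*} [RCLike 𝕜]
  [NormedAddCommGroup X] [InnerProductSpace 𝕜 X]
  [NormedAddCommGroup S] [InnerProductSpace 𝕜 S]
  [NormedAddCommGroup Z] [InnerProductSpace 𝕜 Z]

instance (φ : ℕ+ → X) (r : ℕ+) : FiniteDimensional 𝕜 (modeSpan 𝕜 φ r) :=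
  FiniteDimensional.span_of_finite 𝕜 ((Set.finite_Iic r).image _)

theorem Orthonormal.summable_inner_smul [CompleteSpace S] {ι : Type*} {e : ι → S}
    (he : Orthonormal 𝕜 e) (g : S) : Summable fun i => inner 𝕜 (e i) g • e i :=
  (he.orthogonalFamily.summable_iff_norm_sq_summable fun i => inner 𝕜 (e i) g).mpr
    (he.inner_products_summable g)

variable {K : S →L[𝕜] X} {σ : ℕ+ → ℝ} {f : ℕ+ → S} {φ : ℕ+ → X}

/-- Discarding the zero singular values leaves an orthonormal family `f_k`, and `K f_k = σ_k φ_k`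
removes the modes. -/
theorem IsSVD.hasSum_apply_right (h : IsSVD K σ f φ) (g : S) :
    HasSum (fun k : PODOrder σ => inner 𝕜 (f k) g • K (f k)) (K g) := by
  have h1 : HasSum ((fun k : ℕ+ => ((σ k : 𝕜) * inner 𝕜 (f k) g) • φ k) ∘
      ((↑) : {k : ℕ+ | 0 < σ k} → ℕ+)) (K g) := by
    refine (hasSum_subtype_iff_of_support_subset fun k hk => ?_).mpr (h.hasSum g)
    refine (h.nonneg k).lt_of_ne fun h0 => hk ?_
    simp [← h0]
  have h2 : (fun k : PODOrder σ => inner 𝕜 (f k) g • K (f k)) =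
      fun k : PODOrder σ => ((σ k : 𝕜) * inner 𝕜 (f k) g) • φ k :=
    funext fun k => by rw [h.apply_right k.2, smul_smul, mul_comm]
  rw [h2]
  exact h1

/-- An operator that vanishes on the kernel of `K` can be expanded along the singular vectors. -/
theorem IsSVD.hasSum_of_ker_le [CompleteSpace S] (h : IsSVD K σ f φ) (E : S →L[𝕜] Z)
    (hE : ∀ g, K g = 0 → E g = 0) (g : S) :
    HasSum (fun k : PODOrder σ => inner 𝕜 (f k) g • E (f k)) (E g) := by
  -- `g'` is the projection of `g` onto the closed span of the `f_k`. It has the same image under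
  -- `K`, so `g - g'` is in the kernel of `K` and hence of `E`.
  obtain ⟨g', hg'⟩ := h.orthonormal_right.summable_inner_smul g
  have hK : K g' = K g := by
    have h1 := hg'.mapL K
    simp only [map_smul] at h1
    exact h1.unique (h.hasSum_apply_right g)
  have hE' : E g' = E g := by
    rw [← sub_eq_zero, ← map_sub]
    exact hE _ (by rw [map_sub, hK, sub_self])
  rw [← hE']
  simpa only [map_smul] using hg'.mapL E

/-- The modes with positive singular value are linearly independent vectors in the
finite-dimensional range of `K`. -/
theorem IsSVD.finite_podOrder (h : IsSVD K σ f φ) (hK : podRank K < ⊤) :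
    Finite (PODOrder σ) := by
  have hfin : Module.Finite 𝕜 (K : S →ₗ[𝕜] X).range :=
    Module.rank_lt_aleph0_iff.mp (Cardinal.toENat_lt_top.mp hK)
  have hmem (k : PODOrder σ) : φ k ∈ (K : S →ₗ[𝕜] X).range := h.mode_mem (LinearMap.mem_range_self _) k.2
  have hli : LinearIndependent 𝕜 fun k : PODOrder σ =>
      (⟨φ k, hmem k⟩ : (K : S →ₗ[𝕜] X).range) :=
    LinearIndependent.of_comp (Submodule.subtype _) h.orthonormal_left.linearIndependent
  exact hli.finite

end SVD

/-! ### Tails of series indexed by the orders -/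

section Tail

variable {σ : ℕ+ → ℝ}

/-- The indices up to `r` form finite sets that exhaust the orders, so these are sums over
complements of finite sets. Summability is not needed: for a non-summable `b` every such sum has the
default value zero. -/
theorem PODOrder.tendsto_tsum_tail (b : PODOrder σ → ℝ) :
    Tendsto (fun r : PODOrder σ => ∑' k : {k : ℕ+ // (r : ℕ+) < k ∧ 0 < σ k}, b ⟨k, k.2.2⟩)
      atTop (𝓝 0) := by
  have hfin (r : PODOrder σ) : (Set.Iic r).Finite :=
    ((Set.finite_Iic (r : ℕ+)).preimage Subtype.val_injective.injOn).subset fun k hk => hk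
  have hI : Tendsto (fun r : PODOrder σ => (hfin r).toFinset) atTop atTop := by
    refine tendsto_atTop_finset_of_monotone (fun r r' hr k hk => ?_) fun k => ⟨k, by simp⟩
    simp only [Set.Finite.mem_toFinset, Set.mem_Iic] at hk ⊢
    exact hk.trans hr
  refine ((tendsto_tsum_compl_atTop_zero b).comp hI).congr fun r => ?_
  let e : {k : ℕ+ // (r : ℕ+) < k ∧ 0 < σ k} ≃ {k // k ∉ (hfin r).toFinset} :=
    { toFun := fun k => ⟨⟨k, k.2.2⟩, by
        simpa [← Subtype.coe_lt_coe] using k.2.1⟩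
      invFun := fun k => ⟨k.1, by
        simpa [← Subtype.coe_lt_coe] using k.2, k.1.2⟩
      left_inv := fun _ => rfl
      right_inv := fun _ => rfl }
  exact (e.tsum_eq fun k => b k).symm

theorem PODOrder.tendsto_zero_of_le_tsum {ε : PODOrder σ → ℝ} (hε : ∀ r, 0 ≤ ε r)
    {a : PODOrder σ → PODOrder σ → ℝ}
    (ha : ∀ r : PODOrder σ, Summable fun k : {k : ℕ+ // (r : ℕ+) < k ∧ 0 < σ k} => a r ⟨k, k.2.2⟩)
    (hεa : ∀ r : PODOrder σ, ε r ≤ ∑' k : {k : ℕ+ // (r : ℕ+) < k ∧ 0 < σ k}, a r ⟨k, k.2.2⟩)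
    {b : PODOrder σ → ℝ} (hb : Summable b) (hab : ∀ r k, a r k ≤ b k) :
    Tendsto ε atTop (𝓝 0) := by
  refine squeeze_zero hε (fun r => (hεa r).trans ?_) (PODOrder.tendsto_tsum_tail b)
  refine (ha r).tsum_le_tsum (fun k => hab r _) (hb.comp_injective (i := fun k :
    {k : ℕ+ // (r : ℕ+) < k ∧ 0 < σ k} => (⟨k, k.2.2⟩ : PODOrder σ)) fun k l hkl => ?_)
  exact Subtype.ext (congrArg (fun z : PODOrder σ => (z : ℕ+)) hkl)

end Tail

/-! ### Density and extension to `X`. -/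

section Extension

variable {𝕜 X : Type*} [RCLike 𝕜] [NormedAddCommGroup X] [InnerProductSpace 𝕜 X] [CompleteSpace X]

/-- Uniformly bounded operators on a dense subspace `D`, converging to the identity on a dense
subset of `D`, extend to bounded operators on `X` that converge to the identity on `X`. -/
theorem exists_extend_tendsto {ι : Type*} {l : Filter ι} {D : Submodule 𝕜 X} {R : Set X}
    (hR : Dense R) (hRD : R ⊆ D) (Q : ι → D →ₗ[𝕜] X) {C : ℝ} (hQ : ∀ r x, ‖Q r x‖ ≤ C * ‖(x : X)‖)
    (hlim : ∀ x (hx : x ∈ R), Tendsto (fun r => ‖x - Q r ⟨x, hRD hx⟩‖) l (𝓝 0)) :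
    ∃ T : ι → X →L[𝕜] X, (∀ r (x : D), T r x = Q r x) ∧
      ∀ x, Tendsto (fun r => T r x) l (𝓝 x) := by
  have hD : Dense (D : Set X) := hR.mono hRD
  have hDr : DenseRange D.subtypeL := hD.denseRange_val
  let T : ι → X →L[𝕜] X := fun r => ((Q r).mkContinuous C (hQ r)).extend D.subtypeL
  have hT (r : ι) (x : D) : T r x = Q r x :=
    ContinuousLinearMap.extend_eq _ hDr isUniformEmbedding_subtype_val.isUniformInducing x
  have hC (r : ι) (x : X) : ‖T r x‖ ≤ C * ‖x‖ := by
    refine hDr.induction_on (p := fun x => ‖T r x‖ ≤ C * ‖x‖) x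
      (isClosed_le (T r).continuous.norm (continuous_const.mul continuous_norm)) fun x => ?_
    simpa [hT] using hQ r x
  refine ⟨T, hT, fun x => Metric.tendsto_nhds.mpr fun ε hε => ?_⟩
  have hC' : 0 < |C| + 1 := by positivity
  -- The approximation costs `|C| ‖x - y‖` through `T r` and `‖x - y‖` directly, together less than
  -- `ε / 2`; the error at `y` takes the other half.
  obtain ⟨y, hy, hxy⟩ := hR.exists_dist_lt x (show 0 < ε / (2 * (|C| + 1)) by positivity)
  filter_upwards [(hlim y hy).eventually (gt_mem_nhds (half_pos hε))] with r hr
  rw [lt_div_iff₀ (by positivity), dist_eq_norm] at hxy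
  rw [dist_eq_norm]
  have h1 : T r x - x = T r (x - y) - (y - Q r ⟨y, hRD hy⟩) - (x - y) := by
    rw [map_sub, hT r ⟨y, hRD hy⟩ |>.symm]
    abel
  have h2 : ‖T r (x - y)‖ ≤ |C| * ‖x - y‖ :=
    (hC r _).trans (mul_le_mul_of_nonneg_right (le_abs_self C) (norm_nonneg _))
  have h3 := norm_sub_le (T r (x - y) - (y - Q r ⟨y, hRD hy⟩)) (x - y)
  have h4 := norm_sub_le (T r (x - y)) (y - Q r ⟨y, hRD hy⟩)
  rw [h1]
  linarith

end Extension

/-- The orthogonal complement of the range of `K` is `ker K*`, and a nonzero vector there would be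
an eigenvector of `K K*` for the eigenvalue `0`. -/
theorem PODEigenvaluesNonzero.denseRange {𝕜 X S : Type*} [RCLike 𝕜]
    [NormedAddCommGroup X] [InnerProductSpace 𝕜 X] [CompleteSpace X]
    [NormedAddCommGroup S] [InnerProductSpace 𝕜 S] [CompleteSpace S] {K : S →L[𝕜] X}
    (h : PODEigenvaluesNonzero K) : DenseRange K := by
  have hker : ((K : S →ₗ[𝕜] X).range)ᗮ = ⊥ := by
    rw [ContinuousLinearMap.orthogonal_range, LinearMap.ker_eq_bot']
    intro x hx
    by_contra hx0
    refine h 0 (Module.End.hasEigenvalue_of_hasEigenvector (x := x)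
      (Module.End.hasEigenvector_iff.mpr ⟨?_, hx0⟩)) rfl
    rw [Module.End.mem_eigenspace_iff]
    have hx' : ContinuousLinearMap.adjoint K x = 0 := hx
    simp [hx']
  have h1 := Submodule.topologicalClosure_eq_top_iff.mpr hker
  exact Submodule.dense_iff_topologicalClosure_eq_top.mpr h1

/-! ### The error operator and its singular expansion. -/

section POD

variable {𝕜 : Type u} [RCLike 𝕜]
  {X : Type v} [NormedAddCommGroup X] [InnerProductSpace 𝕜 X] [CompleteSpace X]
  {Y : Type w} [NormedAddCommGroup Y] [InnerProductSpace 𝕜 Y] [CompleteSpace Y]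
  {S : Type u} [NormedAddCommGroup S] [InnerProductSpace 𝕜 S]
  {L : X →ₗ.[𝕜] Y} {K : S →L[𝕜] X}

/-- The error operator `(I - L⁻¹ Π L) K` is Hilbert–Schmidt. -/
theorem IsPODOperator.exists_errorOperator (hK : IsPODOperator L K) {U : Submodule 𝕜 X}
    [FiniteDimensional 𝕜 U] {P : Y →L[𝕜] Y} (hP : LinearMap.IsProj (L.imageOf U) P) :
    ∃ E : S →L[𝕜] X, IsHilbertSchmidt E ∧
      ∀ g, E g = K g - conjProj L P hP ⟨K g, hK.apply_mem_domain g⟩ := by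
  obtain ⟨A, hA, hAK⟩ := hK.exists_comp
  obtain ⟨B, hB⟩ := exists_conjProj_eq_comp hP
  refine ⟨K - B ∘L A, hK.isHilbertSchmidt.sub (hA.comp_left B), fun g => ?_⟩
  rw [hB, hAK]
  rfl

variable {σ : ℕ+ → ℝ} {f : ℕ+ → S} {φ : ℕ+ → X}

theorem IsSVD.norm_errorOperator_apply (h : IsSVD K σ f φ) (hK : IsPODOperator L K)
    {U : Submodule 𝕜 X} {P : Y →L[𝕜] Y} (hP : LinearMap.IsProj (L.imageOf U) P) {E : S →L[𝕜] X}
    (hE : ∀ g, E g = K g - conjProj L P hP ⟨K g, hK.apply_mem_domain g⟩) (k : PODOrder σ) :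
    ‖E (f k)‖ = σ k * ‖φ k - conjProj L P hP ⟨φ k, h.mode_mem hK.apply_mem_domain k.2⟩‖ := by
  have h1 : (⟨K (f k), hK.apply_mem_domain (f k)⟩ : L.domain) =
      (σ k : 𝕜) • ⟨φ k, h.mode_mem hK.apply_mem_domain k.2⟩ :=
    Subtype.ext (h.apply_right k.2)
  rw [hE, h1, map_smul, h.apply_right k.2, ← smul_sub, norm_smul, RCLike.norm_ofReal,
    abs_of_pos k.2]

/-- The expansion starts after `r` because `L⁻¹ Π L` fixes the modes that span `X_r`. -/
theorem IsSVD.hasSum_errorOperator [CompleteSpace S] (h : IsSVD K σ f φ) (hL : L.toFun.ker = ⊥)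
    (hK : IsPODOperator L K) (r : PODOrder σ) {P : Y →L[𝕜] Y}
    (hP : LinearMap.IsProj (L.imageOf (modeSpan 𝕜 φ r)) P) {E : S →L[𝕜] X}
    (hE : ∀ g, E g = K g - conjProj L P hP ⟨K g, hK.apply_mem_domain g⟩) (g : S) :
    HasSum (fun k : {k : ℕ+ // (r : ℕ+) < k ∧ 0 < σ k} => inner 𝕜 (f k) g • E (f k)) (E g) := by
  have hker (g : S) (hg : K g = 0) : E g = 0 := by
    have h1 : (⟨K g, hK.apply_mem_domain g⟩ : L.domain) = 0 := Subtype.ext hg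
    rw [hE, h1, map_zero, hg, sub_zero]
  have hinj : Function.Injective
      fun k : {k : ℕ+ // (r : ℕ+) < k ∧ 0 < σ k} => (⟨k, k.2.2⟩ : PODOrder σ) :=
    fun k l hkl => Subtype.ext (congrArg (fun z : PODOrder σ => (z : ℕ+)) hkl)
  refine (hinj.hasSum_iff fun k hk => ?_).mpr (h.hasSum_of_ker_le E hker g)
  have hkr : (k : ℕ+) ≤ r := not_lt.mp fun hlt => hk ⟨⟨k, hlt, k.2⟩, rfl⟩
  have hself := conjProj_eq_self hL hP (x := ⟨φ k, h.mode_mem hK.apply_mem_domain k.2⟩)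
    (Submodule.subset_span ⟨k, hkr, rfl⟩)
  have hnorm := h.norm_errorOperator_apply hK hP hE k
  rw [hself] at hnorm
  simp only [sub_self, norm_zero, mul_zero, norm_eq_zero] at hnorm
  rw [hnorm, smul_zero]

end POD

/-- A finite-dimensional range is closed, so a dense one is all of `X`. -/
theorem finiteDimensional_of_denseRange {𝕜 X S : Type*} [RCLike 𝕜]
    [NormedAddCommGroup X] [InnerProductSpace 𝕜 X]
    [NormedAddCommGroup S] [InnerProductSpace 𝕜 S] {K : S →L[𝕜] X} (hd : DenseRange K)
    (hK : podRank K < ⊤) : FiniteDimensional 𝕜 X := by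
  have : Module.Finite 𝕜 (K : S →ₗ[𝕜] X).range :=
    Module.rank_lt_aleph0_iff.mp (Cardinal.toENat_lt_top.mp hK)
  have h1 : (K : S →ₗ[𝕜] X).range = ⊤ := by
    rw [← (Submodule.closed_of_finiteDimensional
      (K : S →ₗ[𝕜] X).range).submodule_topologicalClosure_eq]
    exact Submodule.dense_iff_topologicalClosure_eq_top.mp hd
  rw [h1] at this
  exact Module.Finite.equiv (Submodule.topEquiv (R := 𝕜) (M := X))

theorem mainTheorem5 {𝕜 : Type u} [RCLike 𝕜]
    {X : Type v} [NormedAddCommGroup X] [InnerProductSpace 𝕜 X] [CompleteSpace X]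
    [TopologicalSpace.SeparableSpace X]
    {Y : Type w} [NormedAddCommGroup Y] [InnerProductSpace 𝕜 Y] [CompleteSpace Y]
    [TopologicalSpace.SeparableSpace Y]
    {S : Type u} [NormedAddCommGroup S] [InnerProductSpace 𝕜 S] [CompleteSpace S]
    -- the operator `L`, invertible from its domain onto its range
    (L : X →ₗ.[𝕜] Y) (hLinj : L.toFun.ker = ⊥)
    -- the POD operator and its singular value decomposition
    (K : S →L[𝕜] X) (hK : IsPODOperator L K)
    (σ : ℕ+ → ℝ) (f : ℕ+ → S) (φ : ℕ+ → X) (hSVD : IsSVD K σ f φ)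
    -- bounded projections of `Y` onto `Y_r = L X_r`
    (P : PODOrder σ → Y →L[𝕜] Y)
    (hP : ∀ r : PODOrder σ, LinearMap.IsProj (L.imageOf (modeSpan 𝕜 φ r)) (P r))
    (hbdd : podRank K < ⊤ ∨ L.IsBddOp ∨ L.inverse.IsBddOp) :
    -- the error bound
    (∀ (g : S) (r : PODOrder σ),
      Summable (fun k : {k : ℕ+ // (r : ℕ+) < k ∧ 0 < σ k} =>
        σ k * ‖inner 𝕜 (f k) g‖ *
          ‖φ k - conjProj L (P r) (hP r) ⟨φ k, hSVD.mode_mem hK.apply_mem_domain k.2.2⟩‖) ∧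
      ‖K g - conjProj L (P r) (hP r) ⟨K g, hK.apply_mem_domain g⟩‖ ≤
        ∑' k : {k : ℕ+ // (r : ℕ+) < k ∧ 0 < σ k},
          σ k * ‖inner 𝕜 (f k) g‖ *
            ‖φ k - conjProj L (P r) (hP r) ⟨φ k, hSVD.mode_mem hK.apply_mem_domain k.2.2⟩‖) ∧
    -- convergence on the range of `K`
    ((podRank K < ⊤ ∨
        (L.inverse.IsBddOp ∧ ∃ C : ℝ, ∀ r, ‖P r‖ ≤ C) ∨
        (∃ C : ℝ, ∀ (r : PODOrder σ) (x : L.domain),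
          ‖conjProj L (P r) (hP r) x‖ ≤ C * ‖(x : X)‖)) →
      ∀ g : S, Tendsto
        (fun r : PODOrder σ => ‖K g - conjProj L (P r) (hP r) ⟨K g, hK.apply_mem_domain g⟩‖)
        atTop (𝓝 0)) ∧
    -- convergence on all of `X`, for the unique continuous extensions to `X`
    ((podRank K = ⊤ → ∃ C : ℝ, ∀ (r : PODOrder σ) (x : L.domain),
          ‖conjProj L (P r) (hP r) x‖ ≤ C * ‖(x : X)‖) →
      PODEigenvaluesNonzero K →
      Dense (L.domain : Set X) ∧
      ∃ T : PODOrder σ → X →L[𝕜] X,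
        (∀ (r : PODOrder σ) (x : L.domain), T r x = conjProj L (P r) (hP r) x) ∧
        ∀ x : X, Tendsto (fun r : PODOrder σ => T r x) atTop (𝓝 x)) := by
  choose E hEHS hE using fun r : PODOrder σ => hK.exists_errorOperator (hP r)
  have hterm (r k : PODOrder σ) (g : S) :
      σ k * ‖inner 𝕜 (f k) g‖ *
        ‖φ k - conjProj L (P r) (hP r) ⟨φ k, hSVD.mode_mem hK.apply_mem_domain k.2⟩‖
        = ‖inner 𝕜 (f k) g‖ * ‖E r (f k)‖ := by
    rw [hSVD.norm_errorOperator_apply hK (hP r) (hE r) k]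
    ring
  have hsum (g : S) (r : PODOrder σ) :
      Summable fun k : {k : ℕ+ // (r : ℕ+) < k ∧ 0 < σ k} => ‖inner 𝕜 (f k) g‖ * ‖E r (f k)‖ :=
    ((hEHS r).summable_norm_inner_mul hSVD.orthonormal_right g).comp_injective
      (i := fun k : {k : ℕ+ // (r : ℕ+) < k ∧ 0 < σ k} => (⟨k, k.2.2⟩ : PODOrder σ))
      fun k l hkl => Subtype.ext (congrArg (fun z : PODOrder σ => (z : ℕ+)) hkl)
  have hle (g : S) (r : PODOrder σ) :
      ‖E r g‖ ≤ ∑' k : {k : ℕ+ // (r : ℕ+) < k ∧ 0 < σ k}, ‖inner 𝕜 (f k) g‖ * ‖E r (f k)‖ := by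
    rw [← (hSVD.hasSum_errorOperator hLinj hK r (hP r) (hE r) g).tsum_eq]
    simp only [← norm_smul]
    refine norm_tsum_le_tsum_norm ?_
    simp only [norm_smul]
    exact hsum g r
  have hconv (hcase : podRank K < ⊤ ∨
        (L.inverse.IsBddOp ∧ ∃ C : ℝ, ∀ r, ‖P r‖ ≤ C) ∨
        (∃ C : ℝ, ∀ (r : PODOrder σ) (x : L.domain),
          ‖conjProj L (P r) (hP r) x‖ ≤ C * ‖(x : X)‖)) (g : S) : Tendsto
        (fun r : PODOrder σ => ‖K g - conjProj L (P r) (hP r) ⟨K g, hK.apply_mem_domain g⟩‖)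
        atTop (𝓝 0) := by
    simp only [← hE]
    -- Each of the three cases only has to supply a summable majorant that does not depend on `r`.
    suffices h : ∃ b : PODOrder σ → ℝ, Summable b ∧
        ∀ r k : PODOrder σ, ‖inner 𝕜 (f k) g‖ * ‖E r (f k)‖ ≤ b k by
      obtain ⟨b, hb, hab⟩ := h
      exact PODOrder.tendsto_zero_of_le_tsum (fun r => norm_nonneg _)
        (a := fun r k => ‖inner 𝕜 (f k) g‖ * ‖E r (f k)‖) (hsum g) (hle g) hb hab
    rcases hcase with hfin | ⟨⟨M, hM⟩, C, hC⟩ | ⟨C, hC⟩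
    -- There are finitely many orders, so summing the terms over all `r` gives a majorant.
    · have := hSVD.finite_podOrder hfin
      have := Fintype.ofFinite (PODOrder σ)
      exact ⟨fun k => ∑ r, ‖inner 𝕜 (f k) g‖ * ‖E r (f k)‖, Summable.of_finite, fun r k =>
        Finset.single_le_sum (f := fun r => ‖inner 𝕜 (f k) g‖ * ‖E r (f k)‖)
          (fun r _ => by positivity) (Finset.mem_univ r)⟩
    -- Here `‖L⁻¹ Π_r L K f_k‖ ≤ M C ‖A f_k‖` with `A = L K`, so the Hilbert–Schmidt property of `A`
    -- gives summability.
    · obtain ⟨A, hA, hAK⟩ := hK.exists_comp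
      refine ⟨fun k => ‖inner 𝕜 (f k) g‖ * ‖K (f k)‖ +
        |M| * |C| * (‖inner 𝕜 (f k) g‖ * ‖A (f k)‖),
        (hK.isHilbertSchmidt.summable_norm_inner_mul hSVD.orthonormal_right g).add
          ((hA.summable_norm_inner_mul hSVD.orthonormal_right g).mul_left _), fun r k => ?_⟩
      have h1 : ‖conjProj L (P r) (hP r) ⟨K (f k), hK.apply_mem_domain (f k)⟩‖
          ≤ |M| * (|C| * ‖A (f k)‖) := by
        refine (norm_conjProj_le (hP r) hM _).trans ?_
        rw [hAK]
        refine mul_le_mul (le_abs_self M) (((P r).le_opNorm _).trans ?_) (norm_nonneg _)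
          (abs_nonneg M)
        exact mul_le_mul_of_nonneg_right ((hC r).trans (le_abs_self C)) (norm_nonneg _)
      have h2 : ‖E r (f k)‖ ≤ ‖K (f k)‖ + |M| * (|C| * ‖A (f k)‖) := by
        rw [hE]
        exact (norm_sub_le _ _).trans (by gcongr)
      calc ‖inner 𝕜 (f k) g‖ * ‖E r (f k)‖
          ≤ ‖inner 𝕜 (f k) g‖ * (‖K (f k)‖ + |M| * (|C| * ‖A (f k)‖)) := by gcongr
        _ = _ := by ring
    · refine ⟨fun k => (1 + C) * (‖inner 𝕜 (f k) g‖ * ‖K (f k)‖),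
        (hK.isHilbertSchmidt.summable_norm_inner_mul hSVD.orthonormal_right g).mul_left _,
        fun r k => ?_⟩
      have h2 : ‖E r (f k)‖ ≤ (1 + C) * ‖K (f k)‖ := by
        rw [hE, one_add_mul]
        exact (norm_sub_le _ _).trans (by gcongr; exact hC r ⟨K (f k), _⟩)
      calc ‖inner 𝕜 (f k) g‖ * ‖E r (f k)‖
          ≤ ‖inner 𝕜 (f k) g‖ * ((1 + C) * ‖K (f k)‖) := by gcongr
        _ = _ := by ring
  refine ⟨fun g r => ?_, hconv, fun hunif hev => ?_⟩
  · have h1 : (fun k : {k : ℕ+ // (r : ℕ+) < k ∧ 0 < σ k} => σ k * ‖inner 𝕜 (f k) g‖ *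
        ‖φ k - conjProj L (P r) (hP r) ⟨φ k, hSVD.mode_mem hK.apply_mem_domain k.2.2⟩‖) =
        fun k : {k : ℕ+ // (r : ℕ+) < k ∧ 0 < σ k} => ‖inner 𝕜 (f k) g‖ * ‖E r (f k)‖ :=
      funext fun k => hterm r ⟨k, k.2.2⟩ g
    rw [h1, ← hE]
    exact ⟨hsum g r, hle g r⟩
  · have hdense : Dense (Set.range K) := hev.denseRange
    have hsub : Set.range K ⊆ L.domain := Set.range_subset_iff.mpr hK.apply_mem_domain
    have hbound : ∃ C : ℝ, ∀ (r : PODOrder σ) (x : L.domain),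
        ‖conjProj L (P r) (hP r) x‖ ≤ C * ‖(x : X)‖ := by
      rcases eq_or_ne (podRank K) ⊤ with htop | htop
      · exact hunif htop
      have hlt := lt_top_iff_ne_top.mpr htop
      -- In finite rank, density makes `X` finite-dimensional, so each of the finitely many
      -- operators is bounded and the largest norm serves for all `r`.
      have := hSVD.finite_podOrder hlt
      have hfin : FiniteDimensional 𝕜 X := finiteDimensional_of_denseRange hdense hlt
      obtain ⟨C, hC⟩ := (Set.finite_range fun r => ‖LinearMap.toContinuousLinearMap
        (conjProj L (P r) (hP r))‖).bddAbove
      refine ⟨C, fun r x => ?_⟩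
      exact ((LinearMap.toContinuousLinearMap (conjProj L (P r) (hP r))).le_opNorm x).trans
        (mul_le_mul_of_nonneg_right (hC ⟨r, rfl⟩) (norm_nonneg _))
    obtain ⟨C, hC⟩ := hbound
    refine ⟨hdense.mono hsub, exists_extend_tendsto hdense hsub _ hC ?_⟩
    rintro _ ⟨g, rfl⟩
    exact hconv (Or.inr (Or.inr ⟨C, hC⟩)) g
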